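/- Let $n\ge 0$ and let $f:\mathbb{C}^n\to\mathbb{C}$ be a mixed polynomial, i.e. $f$ is given by a complex polynomial in $z_1,\dots,z_n,\bar z_1,\dots,\bar z_n$. Write $\overline{\mathrm{d}f}=\left(\overline{\partial f/\partial z_1},\dots,\overline{\partial f/\partial z_n}\right)$ and $\overline{\mathrm{d}}f=\left(\partial f/\partial\bar z_1,\dots,\partial f/\partial\bar z_n\right)$, and define: - $\operatorname{Sing} f$, the set of $\mathbf z\in\mathbb{C}^n$ at which the real differential of $f:\mathbb{R}^{2n}\to\mathbb{R}^2$ is not surjective; - the Milnor set $M(f)=\{\mathbf z\in\mathbb{C}^n \mid \exists \lambda\in\mathbb{R},\ \exists\mu\in\mathbb{C}\setminus\{0\}:\ \lambda\mathbf z=\mu\,\overline{\mathrm{d}f}(\mathbf z)+\bar\mu\,\overline{\mathrm{d}}f(\mathbf z)\}$; - $S(f)$, the set of $c\in\mathbb{C}$ for which there is a sequence $(\mathbf z_k)$ in $M(f)$ with $\|\mathbf z_k\|\to\infty$ and $f(\mathbf z_k)\to c$. For $V\subset\mathbb{C}$, the restriction $f_|:f^{-1}(V)\to V$ is called a locally trivial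 $C^\infty$ fibration over $V$ if every $c\in V$ has an open neighbourhood $U$ in $\mathbb{C}$, contained in $V$, for which there are a $C^\infty$ manifold $F$ without boundary (possibly empty) and a $C^\infty$ diffeomorphism $f^{-1}(U)\to U\times F$ whose first component is $f$. The bifurcation set $B(f)$ is the smallest set $\Lambda\subset\mathbb{C}$ such that $f_|$ is a locally trivial $C^\infty$ fibration over $\mathbb{C}\setminus\Lambda$; equivalently, $B(f)$ is the set of values with no open neighbourhood $U$ over which such a diffeomorphism exists. Then the restriction $$f_|:\mathbb{C}^n\setminus f^{-1}\big(f(\operatorname{Sing} f)\cup S(f)\big)\longrightarrow \mathbb{C}\setminus\big(f(\operatorname{Sing} f)\cup S(f)\big)$$ is a locally trivial $C^\infty$ fibration. In particular $B(f)\subset f(\operatorname{Sing} f)\cup S(f)$. -/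

import Mathlib

open scoped Manifold ContDiff ComplexConjugate
open Filter Topology

/-- The Hermitian space `ℂⁿ`, with its Euclidean norm. -/
abbrev Cn (n : ℕ) : Type := EuclideanSpace ℂ (Fin n)

/-- `f : ℂⁿ → ℂ` is a mixed polynomial: a complex polynomial in the `2n` variables
`z₁, …, zₙ, z̄₁, …, z̄ₙ`. -/
def IsMixedPolynomial {n : ℕ} (f : Cn n → ℂ) : Prop :=
  ∃ P : MvPolynomial (Fin n ⊕ Fin n) ℂ, ∀ z : Cn n,
    f z = MvPolynomial.eval (Sum.elim (fun k => z k) (fun k => conj (z k))) P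

/-- `∂f/∂x_k`, where `z_k = x_k + i y_k`. -/
noncomputable def partialX {n : ℕ} (f : Cn n → ℂ) (z : Cn n) (k : Fin n) : ℂ :=
  fderiv ℝ f z (EuclideanSpace.single k 1)

/-- `∂f/∂y_k`, where `z_k = x_k + i y_k`. -/
noncomputable def partialY {n : ℕ} (f : Cn n → ℂ) (z : Cn n) (k : Fin n) : ℂ :=
  fderiv ℝ f z (EuclideanSpace.single k Complex.I)

/-- `∂f/∂z_k = (∂f/∂x_k - i ∂f/∂y_k) / 2`. -/
noncomputable def partialZ {n : ℕ} (f : Cn n → ℂ) (z : Cn n) (k : Fin n) : ℂ :=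
  (partialX f z k - Complex.I * partialY f z k) / 2

/-- `∂f/∂z̄_k = (∂f/∂x_k + i ∂f/∂y_k) / 2`. -/
noncomputable def partialZbar {n : ℕ} (f : Cn n → ℂ) (z : Cn n) (k : Fin n) : ℂ :=
  (partialX f z k + Complex.I * partialY f z k) / 2

/-- `Sing f`: the critical points of `f` as a map from `ℝ²ⁿ` to `ℝ²`, that is, the points where the
real differential is not onto. -/
def singularLocus {n : ℕ} (f : Cn n → ℂ) : Set (Cn n) :=
  {z | ¬ Function.Surjective (fderiv ℝ f z)}

/-- The Milnor set `M(f)`: the points `z` for which there are `λ ∈ ℝ` and `μ ∈ ℂ \ {0}` with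
`λ z = μ · conj (df) + conj μ · d̄f`. -/
def milnorSet {n : ℕ} (f : Cn n → ℂ) : Set (Cn n) :=
  {z | ∃ (l : ℝ) (μ : ℂ), μ ≠ 0 ∧
    ∀ k : Fin n, (l : ℂ) * z k = μ * conj (partialZ f z k) + conj μ * partialZbar f z k}

/-- `S(f)`: the asymptotic ρ-nonregular values of `f`. -/
def asymptoticNonregularValues {n : ℕ} (f : Cn n → ℂ) : Set ℂ :=
  {c | ∃ z : ℕ → Cn n, (∀ k, z k ∈ milnorSet f) ∧
    Tendsto (fun k => ‖z k‖) atTop atTop ∧ Tendsto (fun k => f (z k)) atTop (𝓝 c)}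

/-- `f` is a trivial `C^∞` fibration over the open set `U ⊆ ℂ`: the set `W = f⁻¹(U)` is open and, for
some `C^∞` manifold `F` without boundary (possibly empty), there is a `C^∞` diffeomorphism
`W ≃ U × F` whose first component is `f`.
If `U` is nonempty, `F` is automatically Hausdorff and second countable, as it embeds in `W`. -/
def IsTrivialSmoothFibrationOver {n : ℕ} (f : Cn n → ℂ) (U : TopologicalSpace.Opens ℂ) : Prop :=
  ∃ W : TopologicalSpace.Opens (Cn n), (W : Set (Cn n)) = f ⁻¹' (U : Set ℂ) ∧
    ∃ (d : ℕ) (F : Type) (_ : TopologicalSpace F) (_ : ChartedSpace (EuclideanSpace ℝ (Fin d)) F)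
      (_ : IsManifold (𝓡 d) ∞ F)
      (Φ : Diffeomorph 𝓘(ℝ, Cn n) (𝓘(ℝ, ℂ).prod (𝓡 d)) W (U × F) ∞),
      ∀ z : W, ((Φ z).1 : ℂ) = f z

/-- The restriction `f⁻¹(V) → V` of `f` is a locally trivial `C^∞` fibration over `V ⊆ ℂ`: every
point of `V` has an open neighbourhood in `ℂ`, contained in `V`, over which `f` is a trivial `C^∞`
fibration. In particular `V` is then open. -/
def IsLocallyTrivialSmoothFibrationOver {n : ℕ} (f : Cn n → ℂ) (V : Set ℂ) : Prop :=
  ∀ c ∈ V, ∃ U : TopologicalSpace.Opens ℂ, c ∈ U ∧ (U : Set ℂ) ⊆ V ∧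
    IsTrivialSmoothFibrationOver f U

/-- The bifurcation set `B(f)`: the values without any open neighbourhood over which `f` is a trivial
`C^∞` fibration. -/
def bifurcationSet {n : ℕ} (f : Cn n → ℂ) : Set ℂ :=
  {c | ¬ ∃ U : TopologicalSpace.Opens ℂ, c ∈ U ∧ IsTrivialSmoothFibrationOver f U}

/-- `B(f)` is the minimal set `Λ` such that `f` is a locally trivial `C^∞` fibration over the
complement of `Λ`. -/
theorem isLeast_bifurcationSet {n : ℕ} (f : Cn n → ℂ) :
    IsLeast {Λ : Set ℂ | IsLocallyTrivialSmoothFibrationOver f Λᶜ} (bifurcationSet f) := by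
  constructor
  · intro c hc
    obtain ⟨U, hcU, hU⟩ := not_not.mp hc
    exact ⟨U, hcU, fun c' hc' h => h ⟨U, hc', hU⟩, hU⟩
  · intro Λ hΛ c hc
    by_contra h
    obtain ⟨U, hcU, -, hU⟩ := hΛ c h
    exact hc ⟨U, hcU, hU⟩

/-! This is Ehresmann's argument, with control along large spheres replacing properness of `f`. Off
the Milnor set and the origin, `f` and `‖z‖ ^ 2` are jointly submersive
(`surjective_fderiv_prod_of_notMem_milnorSet`). If `c` avoids both exceptional sets, some closed
ball about `c` has no critical points and no Milnor points of large norm above it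
(`exists_forall_closedBall_regular`). Constant fields on the target, cut off to that ball, therefore
lift to smooth fields tangent to all large spheres (`exists_contDiff_lift`), whose integral curves
cannot escape to infinity. Their time-one maps give a reversible transport `τ` between fibres
(`exists_contDiff_transport`), and `z ↦ (f z, τ (z, c - f z))` trivialises `f` over a smaller ball,
with the fibre over `c` as model (`ContDiff.exists_isManifold_fibre`).

The analytic input is smoothness of time-one maps. An integral curve from `x` solves `η - ∫ X ∘ η =
x` in the Banach space `C(I, E)`. For a small Lipschitz constant the left side is a smooth bijection
with invertible derivative, so `η` depends smoothly on `x`; iteration and cut-offs remove the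
smallness. -/

/-! ### Smoothness of the superposition operator on spaces of continuous maps -/

namespace ContinuousMap

universe u

variable {I : Type*} [TopologicalSpace I] [CompactSpace I]

/-- A continuous family of continuous linear maps acts pointwise on continuous maps. -/
noncomputable def pointwiseApplyL (I : Type*) [TopologicalSpace I] [CompactSpace I]
    (E F : Type*) [NormedAddCommGroup E] [NormedSpace ℝ E] [NormedAddCommGroup F]
    [NormedSpace ℝ F] : C(I, E →L[ℝ] F) →L[ℝ] C(I, E) →L[ℝ] C(I, F) :=
  LinearMap.mkContinuous₂
    (LinearMap.mk₂ ℝ (fun (A : C(I, E →L[ℝ] F)) (η : C(I, E)) =>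
        (⟨fun t => A t (η t), by fun_prop⟩ : C(I, F)))
      (fun _ _ _ => by ext; simp) (fun _ _ _ => by ext; simp)
      (fun _ _ _ => by ext; simp) (fun _ _ _ => by ext; simp)) 1
    (fun A η => by
      rw [one_mul]
      refine (ContinuousMap.norm_le _ (by positivity)).2 fun t => ?_
      exact ((A t).le_opNorm _).trans (by gcongr <;> exact ContinuousMap.norm_coe_le_norm _ t))

/-- The mean value inequality on the segment from `γ t` to `γ t + η t` gives the estimate pointwise.
It is uniform in `t` because `η ↦ g' ∘ η` is continuous for the sup norm. -/
theorem hasFDerivAt_comp_left {E F : Type*} [NormedAddCommGroup E] [NormedSpace ℝ E]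
    [NormedAddCommGroup F] [NormedSpace ℝ F] (g : C(E, F)) (g' : C(E, E →L[ℝ] F))
    (hg : ∀ x, HasFDerivAt g (g' x) x) (γ : C(I, E)) :
    HasFDerivAt (fun η : C(I, E) => g.comp η) (pointwiseApplyL I E F (g'.comp γ)) γ := by
  rw [hasFDerivAt_iff_isLittleO_nhds_zero, Asymptotics.isLittleO_iff]
  intro ε hε
  have hcont : Continuous fun η : C(I, E) => g'.comp η := ContinuousMap.continuous_postcomp g'
  obtain ⟨δ, hδ, hball⟩ := (Metric.continuousAt_iff
    (f := fun η : C(I, E) => g'.comp η) (a := γ)).1 hcont.continuousAt ε hε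
  filter_upwards [Metric.ball_mem_nhds (0 : C(I, E)) hδ] with η hη
  rw [mem_ball_zero_iff] at hη
  refine (ContinuousMap.norm_le _ (by positivity)).2 fun t => ?_
  have key := Convex.norm_image_sub_le_of_norm_hasFDerivWithin_le' (𝕜 := ℝ) (f := g) (f' := g')
    (φ := g' (γ t)) (C := ε) (s := segment ℝ (γ t) (γ t + η t)) (x := γ t) (y := γ t + η t)
    (fun x _ => (hg x).hasFDerivWithinAt) ?_ (convex_segment _ _) (left_mem_segment _ _ _)
    (right_mem_segment _ _ _)
  · simp only [add_sub_cancel_left] at key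
    refine key.trans ?_
    gcongr
    exact ContinuousMap.norm_coe_le_norm _ t
  · rw [segment_eq_image']
    rintro _ ⟨s, hs, rfl⟩
    simp only [add_sub_cancel_left]
    have h1 : dist (γ + s • η) γ < δ := by
      rw [dist_eq_norm, add_sub_cancel_left, norm_smul, Real.norm_of_nonneg hs.1]
      exact (mul_le_of_le_one_left (norm_nonneg _) hs.2).trans_lt hη
    have h2 : dist (g' (γ t + s • η t)) (g' (γ t)) < ε :=
      (ContinuousMap.dist_apply_le_dist (f := g'.comp (γ + s • η)) (g := g'.comp γ) t).trans_lt
        (hball h1)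
    rw [dist_eq_norm] at h2
    exact h2.le

/-- The derivative is the superposition operator of `fderiv ℝ g` followed by a bounded linear map,
so induction on the order applies. `E` and `F` share a universe because the induction replaces `F`
by `E →L[ℝ] F`. -/
theorem contDiff_comp_left {E F : Type u} [NormedAddCommGroup E] [NormedSpace ℝ E]
    [NormedAddCommGroup F] [NormedSpace ℝ F] (g : C(E, F)) (hg : ContDiff ℝ ∞ g) :
    ContDiff ℝ ∞ (fun η : C(I, E) => g.comp η) := by
  rw [contDiff_infty]
  intro n
  induction n generalizing F with
  | zero => exact contDiff_zero.2 (ContinuousMap.continuous_postcomp g)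
  | succ n ih =>
    have hg' := (contDiff_infty_iff_fderiv.1 hg)
    have hd := hasFDerivAt_comp_left (I := I) g ⟨fderiv ℝ g, hg'.2.continuous⟩
      (fun x => (hg'.1 x).hasFDerivAt)
    push_cast
    rw [contDiff_succ_iff_hasFDerivAt]
    refine ⟨fun γ => pointwiseApplyL I E F
      ((⟨fderiv ℝ g, hg'.2.continuous⟩ : C(E, E →L[ℝ] F)).comp γ),
      ?_, hd⟩
    exact (pointwiseApplyL I E F).contDiff.comp (ih ⟨fderiv ℝ g, hg'.2.continuous⟩ hg'.2)

end ContinuousMap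

/-! ### Smooth dependence of integral curves on the initial value -/

section Flow

open Set unitInterval
open scoped NNReal

variable {E : Type*} [NormedAddCommGroup E] [NormedSpace ℝ E]

/-- The operator sending a continuous curve to its primitive vanishing at `0`. -/
noncomputable def primitiveL (E : Type*) [NormedAddCommGroup E] [NormedSpace ℝ E] :
    C(I, E) →L[ℝ] C(I, E) :=
  LinearMap.mkContinuous
    { toFun := fun γ => ⟨fun t => ∫ s in (0 : ℝ)..t, IccExtend zero_le_one γ s,
        (intervalIntegral.continuous_primitive
          (fun _ _ => (γ.continuous.Icc_extend' (h := zero_le_one)).intervalIntegrable _ _) 0).comp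
            continuous_subtype_val⟩
      map_add' := fun γ η => by
        ext t
        exact intervalIntegral.integral_add
          ((γ.continuous.Icc_extend' (h := zero_le_one)).intervalIntegrable _ _)
          ((η.continuous.Icc_extend' (h := zero_le_one)).intervalIntegrable _ _)
      map_smul' := fun c γ => by
        ext t
        exact intervalIntegral.integral_smul c (IccExtend zero_le_one γ) } 1
    (fun γ => by
      rw [one_mul]
      refine (ContinuousMap.norm_le _ (norm_nonneg _)).2 fun t => ?_
      refine (intervalIntegral.norm_integral_le_of_norm_le_const (C := ‖γ‖)
        fun s _ => ContinuousMap.norm_coe_le_norm γ _).trans ?_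
      rw [sub_zero, abs_of_nonneg t.2.1]
      exact mul_le_of_le_one_right (norm_nonneg _) t.2.2)

theorem primitiveL_apply (γ : C(I, E)) (t : I) :
    primitiveL E γ t = ∫ s in (0 : ℝ)..t, IccExtend zero_le_one γ s := rfl

theorem norm_primitiveL_le : ‖primitiveL E‖ ≤ 1 :=
  LinearMap.mkContinuous_norm_le _ zero_le_one _

variable [CompleteSpace E]

/-- The time-one map of a smooth vector field with small Lipschitz constant is smooth. -/
theorem exists_contDiff_timeOne_of_lipschitz_half {X : E → E} (hX : ContDiff ℝ ∞ X)
    (hL : LipschitzWith (1 / 2) X) :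
    ∃ T : E → E, ContDiff ℝ ∞ T ∧
      ∀ γ : ℝ → E, IsIntegralCurveOn γ (fun _ => X) (Icc 0 1) → γ 1 = T (γ 0) := by
  set g : C(E, E) := ⟨X, hX.continuous⟩
  -- Integral curves from `x` are the solutions of `η - N η = const x`.
  set N : C(I, E) → C(I, E) := fun η => primitiveL E (g.comp η) with hN
  have hNs : ContDiff ℝ ∞ N :=
    (primitiveL E).contDiff.comp (ContinuousMap.contDiff_comp_left g hX)
  have hNL : LipschitzWith (1 / 2) N := by
    refine LipschitzWith.of_dist_le_mul fun η ζ => ?_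
    rw [dist_eq_norm, ← map_sub]
    refine ((primitiveL E).le_of_opNorm_le norm_primitiveL_le _).trans ?_
    rw [one_mul]
    refine (ContinuousMap.norm_le _ (by positivity)).2 fun t => ?_
    have := hL.dist_le_mul (η t) (ζ t)
    rw [dist_eq_norm] at this
    exact this.trans (by gcongr; exact ContinuousMap.dist_apply_le_dist t)
  set G : C(I, E) → C(I, E) := fun η => η - N η with hG
  have hGs : ContDiff ℝ ∞ G := contDiff_id.sub hNs
  have happ : ApproximatesLinearOn G
      ((ContinuousLinearEquiv.refl ℝ C(I, E) : C(I, E) ≃L[ℝ] C(I, E)) : C(I, E) →L[ℝ] C(I, E))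
      univ (1 / 2) := by
    intro η _ ζ _
    have := hNL.dist_le_mul ζ η
    rw [dist_eq_norm, dist_eq_norm, norm_sub_rev ζ] at this
    have e : G η - G ζ - (η - ζ) = N ζ - N η := by simp only [hG]; abel
    simpa [e] using this
  have hc : Subsingleton C(I, E) ∨ (1 / 2 : ℝ≥0) <
      ‖((ContinuousLinearEquiv.refl ℝ C(I, E)).symm : C(I, E) →L[ℝ] C(I, E))‖₊⁻¹ := by
    rcases subsingleton_or_nontrivial C(I, E) with h | h
    · exact Or.inl h
    · right
      have : ‖((ContinuousLinearEquiv.refl ℝ C(I, E)).symm : C(I, E) →L[ℝ] C(I, E))‖₊ = 1 := by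
        ext
        exact ContinuousLinearMap.norm_id
      rw [this, inv_one]
      exact NNReal.half_lt_self one_ne_zero
  set H : C(I, E) ≃ₜ C(I, E) := happ.toHomeomorph G hc
  have hHG : ∀ η, H η = G η := fun _ => rfl
  have hder : ∀ η, ∃ e : C(I, E) ≃L[ℝ] C(I, E),
      HasFDerivAt H (e : C(I, E) →L[ℝ] C(I, E)) η := by
    intro η
    have hlt : ‖fderiv ℝ N η‖ < 1 :=
      (norm_fderiv_le_of_lipschitz ℝ hNL).trans_lt (by norm_num)
    -- The derivative of `G` is `1 - DN` with `‖DN‖ ≤ 1/2`, invertible by the Neumann series.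
    let U := Units.oneSub (fderiv ℝ N η) hlt
    refine ⟨ContinuousLinearEquiv.ofUnit U, ?_⟩
    exact (hasFDerivAt_id η).sub (hNs.differentiable (by simp) η).hasFDerivAt
  choose e he using hder
  have hHs : ContDiff ℝ ∞ H.symm := H.contDiff_symm he hGs
  refine ⟨fun x => H.symm (ContinuousMap.const I x) 1, ?_, ?_⟩
  · have h1 : ContDiff ℝ ∞ (ContinuousMap.evalCLM ℝ (1 : I) : C(I, E) →L[ℝ] E) :=
      ContinuousLinearMap.contDiff _
    have h2 : ContDiff ℝ ∞ (fun x : E => ContinuousMap.const I x) :=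
      (LinearMap.mkContinuous (⟨⟨fun x : E => ContinuousMap.const I x, fun _ _ => rfl⟩,
        fun _ _ => rfl⟩ : E →ₗ[ℝ] C(I, E)) 1 (fun x => by
          rw [one_mul]
          exact (ContinuousMap.norm_le _ (norm_nonneg _)).2 fun _ => le_rfl)).contDiff
    exact h1.comp (hHs.comp h2)
  · intro γ hγ
    have hcont : ContinuousOn γ (Icc 0 1) := hγ.continuousOn
    set η : C(I, E) := ⟨(Icc (0 : ℝ) 1).domRestrict γ, hcont.domRestrict⟩
    have hη : H η = ContinuousMap.const I (γ 0) := by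
      ext t
      have hint : ∫ s in (0 : ℝ)..t, IccExtend zero_le_one (g.comp η) s = γ t - γ 0 := by
        refine intervalIntegral.integral_eq_sub_of_hasDerivAt_of_le t.2.1
          (hcont.mono (Icc_subset_Icc_right t.2.2)) (fun s hs => ?_)
          (((g.comp η).continuous.Icc_extend' (h := zero_le_one)).intervalIntegrable _ _)
        have hs' : s ∈ Ioo (0 : ℝ) 1 := ⟨hs.1, hs.2.trans_le t.2.2⟩
        have := (hγ s (Ioo_subset_Icc_self hs')).hasDerivAt (Icc_mem_nhds hs'.1 hs'.2)
        rwa [IccExtend_of_mem _ _ (Ioo_subset_Icc_self hs')]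
      have : G η t = γ t - ∫ s in (0 : ℝ)..t, IccExtend zero_le_one (g.comp η) s := rfl
      rw [hHG, this, hint]
      simp
    have : η = H.symm (ContinuousMap.const I (γ 0)) := by rw [← hη, H.symm_apply_apply]
    change γ 1 = H.symm (ContinuousMap.const I (γ 0)) 1
    rw [← this]
    rfl

end Flow

/-! ### Time-one maps: from small Lipschitz constants to a priori bounds -/

section Flow

open Set
open scoped NNReal

variable {E : Type*} [NormedAddCommGroup E] [NormedSpace ℝ E] [CompleteSpace E]

/-- The time-one map of a smooth Lipschitz vector field is smooth. -/
theorem LipschitzWith.exists_contDiff_timeOne {X : E → E} {K : ℝ≥0} (hL : LipschitzWith K X)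
    (hX : ContDiff ℝ ∞ X) :
    ∃ T : E → E, ContDiff ℝ ∞ T ∧
      ∀ γ : ℝ → E, IsIntegralCurveOn γ (fun _ => X) (Icc 0 1) → γ 1 = T (γ 0) := by
  -- The field `X / n` has Lipschitz constant at most `1/2`, and its time-one map is the time-`1/n`
  -- map of `X`, to be iterated `n` times. The summand `1` keeps `n` positive when `K = 0`.
  obtain ⟨n, hn⟩ := exists_nat_ge (2 * K + 1)
  have hn0 : (0 : ℝ≥0) < n := lt_of_lt_of_le (by positivity) hn
  have hn0' : (0 : ℝ) < n := by exact_mod_cast hn0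
  have hL' : LipschitzWith (1 / 2) (fun x => (n : ℝ)⁻¹ • X x) := by
    refine ((lipschitzWith_smul ((n : ℝ)⁻¹)).comp hL).weaken ?_
    have : ‖(n : ℝ)⁻¹‖₊ = (n : ℝ≥0)⁻¹ := by simp
    rw [this, inv_mul_le_iff₀ hn0, mul_one_div, le_div_iff₀ (by positivity), mul_comm]
    exact le_self_add.trans hn
  obtain ⟨T, hT, hTγ⟩ := exists_contDiff_timeOne_of_lipschitz_half (hX.const_smul ((n : ℝ)⁻¹)) hL'
  have hiter : ∀ k : ℕ, ContDiff ℝ ∞ T^[k] := by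
    intro k
    induction k with
    | zero => exact contDiff_id
    | succ k ih => rw [Function.iterate_succ']; exact hT.comp ih
  refine ⟨T^[n], hiter n, fun γ hγ => ?_⟩
  have key : ∀ k : ℕ, k ≤ n → γ (k / n) = T^[k] (γ 0) := by
    intro k
    induction k with
    | zero => simp
    | succ k ih =>
      intro hk
      rw [Function.iterate_succ_apply', ← ih (by omega)]
      have hk' : (k : ℝ) + 1 ≤ n := by exact_mod_cast hk
      have hcurve : IsIntegralCurveOn (fun s : ℝ => γ ((k + s) / n))
          (fun _ x => (n : ℝ)⁻¹ • X x) (Icc 0 1) := by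
        intro s hs
        have hmap : MapsTo (fun s : ℝ => ((k : ℝ) + s) / n) (Icc 0 1) (Icc 0 1) := fun s hs =>
          ⟨div_nonneg (add_nonneg (by positivity) hs.1) hn0'.le,
            (div_le_one hn0').2 (by linarith [hs.2])⟩
        have h1 : HasDerivWithinAt (fun s : ℝ => ((k : ℝ) + s) / n) ((n : ℝ)⁻¹) (Icc 0 1) s := by
          simpa using (((hasDerivAt_id s).const_add (k : ℝ)).div_const (n : ℝ)).hasDerivWithinAt
        exact (hγ _ (hmap hs)).scomp s h1 hmap
      simpa using hTγ _ hcurve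
  simpa [hn0'.ne'] using key n le_rfl

theorem LipschitzWith.exists_isIntegralCurveOn_Icc {X : E → E} {K : ℝ≥0}
    (hL : LipschitzWith K X) {C : ℝ} (hC : ∀ x, ‖X x‖ ≤ C) (x : E) :
    ∃ γ : ℝ → E, γ 0 = x ∧ IsIntegralCurveOn γ (fun _ => X) (Icc 0 1) := by
  have hPL : IsPicardLindelof (fun _ => X) (⟨0, by simp⟩ : Icc (0 : ℝ) 1) x C.toNNReal 0
      C.toNNReal K :=
    IsPicardLindelof.of_time_independent (fun y _ => (hC y).trans (Real.le_coe_toNNReal C))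
      hL.lipschitzOnWith (by simp)
  exact hPL.exists_eq_forall_mem_Icc_hasDerivWithinAt₀

variable [FiniteDimensional ℝ E]

/-- A smooth vector field whose cut-offs have integral curves over `[0, 1]` satisfying an a priori
bound has a smooth time-one map. -/
theorem exists_contDiff_timeOne_of_bounded {X : E → E} (hX : ContDiff ℝ ∞ X)
    (hbound : ∀ r : ℝ, ∃ M : ℝ, ∀ b : E → ℝ, ∀ γ : ℝ → E,
      IsIntegralCurveOn γ (fun _ x => b x • X x) (Icc 0 1) → ‖γ 0‖ ≤ r →
        ∀ t ∈ Icc (0 : ℝ) 1, ‖γ t‖ ≤ M) :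
    ∃ T : E → E, ContDiff ℝ ∞ T ∧
      (∀ x, ∃ γ : ℝ → E, γ 0 = x ∧ IsIntegralCurveOn γ (fun _ => X) (Icc 0 1)) ∧
      ∀ γ : ℝ → E, IsIntegralCurveOn γ (fun _ => X) (Icc 0 1) → γ 1 = T (γ 0) := by
  have hloc : ∀ r : ℝ, ∃ S : E → E, ContDiff ℝ ∞ S ∧
      (∀ x, ‖x‖ ≤ r → ∃ γ : ℝ → E, γ 0 = x ∧ IsIntegralCurveOn γ (fun _ => X) (Icc 0 1)) ∧
      ∀ γ : ℝ → E, IsIntegralCurveOn γ (fun _ => X) (Icc 0 1) → ‖γ 0‖ ≤ r → γ 1 = S (γ 0) := by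
    intro r
    obtain ⟨M, hM⟩ := hbound r
    let b : ContDiffBump (0 : E) := ⟨|M| + 1, |M| + 2, by positivity, by linarith⟩
    have hb1 : ∀ x, ‖x‖ ≤ M → b x = 1 := fun x hx => b.one_of_mem_closedBall (by
      rw [mem_closedBall_zero_iff]
      exact hx.trans ((le_abs_self M).trans (le_add_of_nonneg_right zero_le_one)))
    have hsm : ContDiff ℝ ∞ (fun x => b x • X x) := b.contDiff.smul hX
    have hcs : HasCompactSupport (fun x => b x • X x) := b.hasCompactSupport.smul_right
    obtain ⟨K, hK⟩ := hsm.lipschitzWith_of_hasCompactSupport hcs (by simp)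
    obtain ⟨C, hC⟩ := hcs.exists_bound_of_continuous hsm.continuous
    obtain ⟨S, hS, hSγ⟩ := hK.exists_contDiff_timeOne hsm
    refine ⟨S, hS, fun x hx => ?_, fun γ hγ hr => hSγ γ fun t ht => ?_⟩
    -- The a priori bound keeps the curve of the cut-off field where the cut-off is `1`, so it is an
    -- integral curve of `X` itself.
    · obtain ⟨γ, h0, hγ⟩ := hK.exists_isIntegralCurveOn_Icc hC x
      refine ⟨γ, h0, fun t ht => ?_⟩
      have := hγ t ht
      simpa only [hb1 _ (hM b γ hγ (h0 ▸ hx) t ht), one_smul] using this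
    · have h := hM (fun _ => 1) γ (by simpa using hγ) hr t ht
      simpa only [hb1 _ h, one_smul] using hγ t ht
  choose S hS hex hSγ using hloc
  have hex' : ∀ x, ∃ γ : ℝ → E, γ 0 = x ∧ IsIntegralCurveOn γ (fun _ => X) (Icc 0 1) :=
    fun x => hex ‖x‖ x le_rfl
  choose Γ hΓ0 hΓ using hex'
  have hT : ∀ r x, ‖x‖ ≤ r → Γ x 1 = S r x := fun r x hx => by
    simpa [hΓ0] using hSγ r (Γ x) (hΓ x) (by rwa [hΓ0])
  refine ⟨fun x => Γ x 1, ?_, fun x => ⟨Γ x, hΓ0 x, hΓ x⟩, fun γ hγ => ?_⟩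
  · refine contDiff_iff_contDiffAt.2 fun x => ((hS (‖x‖ + 1)).contDiffAt).congr_of_eventuallyEq ?_
    filter_upwards [continuous_norm.continuousAt.eventually_lt_const (lt_add_one ‖x‖)] with y hy
    exact hT _ y hy.le
  · exact (hSγ _ γ hγ le_rfl).trans (hT ‖γ 0‖ _ le_rfl).symm

end Flow

/-! ### Regular fibres as manifolds -/

section RegularFibre

open Set

variable {E V : Type*} [NormedAddCommGroup E] [NormedSpace ℝ E] [FiniteDimensional ℝ E]
  [NormedAddCommGroup V] [NormedSpace ℝ V] [FiniteDimensional ℝ V]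

/-- A surjective continuous linear map is the first component of a linear isomorphism onto a
product. -/
theorem ContinuousLinearMap.exists_equiv_prod_of_surjective (A : E →L[ℝ] V)
    (hA : Function.Surjective A) {d : ℕ} (hd : d + Module.finrank ℝ V = Module.finrank ℝ E) :
    ∃ (π : E →L[ℝ] EuclideanSpace ℝ (Fin d)) (e : E ≃L[ℝ] V × EuclideanSpace ℝ (Fin d)),
      (e : E →L[ℝ] V × EuclideanSpace ℝ (Fin d)) = A.prod π := by
  have : CompleteSpace E := FiniteDimensional.complete ℝ E
  have : CompleteSpace V := FiniteDimensional.complete ℝ V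
  have hr : (A : E →ₗ[ℝ] V).range = ⊤ := LinearMap.range_eq_top.2 hA
  obtain ⟨q, hq⟩ := A.ker_closedComplemented_of_finiteDimensional_range
  have : CompleteSpace (A : E →ₗ[ℝ] V).ker := FiniteDimensional.complete ℝ _
  have hq' : (q : E →ₗ[ℝ] (A : E →ₗ[ℝ] V).ker).range = ⊤ :=
    LinearMap.range_eq_top.2 fun x => ⟨x, hq x⟩
  have hfin : Module.finrank ℝ (A : E →ₗ[ℝ] V).ker =
      Module.finrank ℝ (EuclideanSpace ℝ (Fin d)) := by
    have := (A : E →ₗ[ℝ] V).finrank_range_add_finrank_ker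
    rw [hr, finrank_top] at this
    rw [finrank_euclideanSpace_fin]
    omega
  let ι := ContinuousLinearEquiv.ofFinrankEq hfin
  refine ⟨(ι : _ →L[ℝ] _).comp q, (A.equivProdOfSurjectiveOfIsCompl q hr hq'
    (LinearMap.isCompl_of_proj hq)).trans ((ContinuousLinearEquiv.refl ℝ V).prodCongr ι), ?_⟩
  ext x <;> rfl

/-- Near a regular point, a smooth map is the first component of a diffeomorphism onto an open
subset of a product. -/
theorem ContDiff.exists_openPartialHomeomorph_of_surjective {f : E → V} (hf : ContDiff ℝ ∞ f)
    {d : ℕ} (hd : d + Module.finrank ℝ V = Module.finrank ℝ E) {p : E}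
    (hp : Function.Surjective (fderiv ℝ f p)) :
    ∃ Ψ : OpenPartialHomeomorph E (V × EuclideanSpace ℝ (Fin d)), p ∈ Ψ.source ∧
      (∀ z, (Ψ z).1 = f z) ∧ ContDiff ℝ ∞ Ψ ∧ ContDiffOn ℝ ∞ Ψ.symm Ψ.target := by
  have : CompleteSpace E := FiniteDimensional.complete ℝ E
  obtain ⟨π, e, he⟩ := (fderiv ℝ f p).exists_equiv_prod_of_surjective hp hd
  set g : E → V × EuclideanSpace ℝ (Fin d) := fun z => (f z, π z)
  have hg : ContDiff ℝ ∞ g := hf.prodMk π.contDiff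
  have hgd : ∀ z, HasFDerivAt g ((fderiv ℝ f z).prod π) z := fun z =>
    ((hf.differentiable (by simp) z).hasFDerivAt).prodMk π.hasFDerivAt
  -- The inverse function theorem gives smoothness of the inverse only where the derivative is
  -- invertible; shrinking to this open set gives it on the whole target.
  set O : Set E := (fderiv ℝ g) ⁻¹'
    range (ContinuousLinearEquiv.toContinuousLinearMap :
      (E ≃L[ℝ] V × EuclideanSpace ℝ (Fin d)) → E →L[ℝ] V × EuclideanSpace ℝ (Fin d))
  have hO : IsOpen O := ContinuousLinearEquiv.isOpen.preimage (hg.continuous_fderiv (by simp))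
  set Ψ := (hg.contDiffAt (x := p)).toOpenPartialHomeomorph g (he ▸ hgd p) (by simp)
  refine ⟨Ψ.restrOpen O hO, ⟨ContDiffAt.mem_toOpenPartialHomeomorph_source _ _ _,
    ⟨e, he.trans (hgd p).fderiv.symm⟩⟩, fun z => rfl, hg, fun y hy => ?_⟩
  obtain ⟨e', he'⟩ := ((Ψ.restrOpen O hO).map_target hy).2
  refine ContDiffAt.contDiffWithinAt
    ((Ψ.restrOpen O hO).contDiffAt_symm (f₀' := e') hy ?_ hg.contDiffAt)
  rw [he']
  exact (hg.differentiable (by simp) _).hasFDerivAt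

/-- The restriction to a level set of the first component of an open partial homeomorphism into a
product. -/
noncomputable def OpenPartialHomeomorph.levelSet {X Y Z : Type*} [TopologicalSpace X]
    [TopologicalSpace Y] [TopologicalSpace Z] {f : X → Y} {c : Y}
    (Ψ : OpenPartialHomeomorph X (Y × Z)) (hΨ : ∀ z, (Ψ z).1 = f z) (p : {z // f z = c}) :
    OpenPartialHomeomorph {z // f z = c} Z := by
  classical
  have hinv : ∀ y, (c, y) ∈ Ψ.target → f (Ψ.symm (c, y)) = c := fun y hy => by
    rw [← hΨ, Ψ.right_inv hy]
  have hpair : ∀ q : {z // f z = c}, (c, (Ψ q).2) = Ψ q := fun q =>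
    Prod.ext (by rw [hΨ]; exact q.2.symm) rfl
  exact
  { toFun := fun q => (Ψ q).2
    -- Off the target, `p` is a junk value.
    invFun := fun y => if h : (c, y) ∈ Ψ.target then ⟨Ψ.symm (c, y), hinv y h⟩ else p
    source := {q | (q : X) ∈ Ψ.source}
    target := {y | (c, y) ∈ Ψ.target}
    map_source' := fun q hq => by
      change (c, (Ψ q).2) ∈ Ψ.target
      rw [hpair]
      exact Ψ.map_source hq
    map_target' := fun y hy => by
      change (c, y) ∈ Ψ.target at hy
      simp [hy]
    left_inv' := fun q hq => by
      have h : (c, (Ψ q).2) ∈ Ψ.target := by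
        rw [hpair]
        exact Ψ.map_source hq
      ext
      simp only [h, dite_true]
      rw [hpair]
      exact Ψ.left_inv hq
    right_inv' := fun y hy => by
      change (c, y) ∈ Ψ.target at hy
      simp only [hy, dite_true]
      rw [Ψ.right_inv hy]
    open_source := Ψ.open_source.preimage continuous_subtype_val
    open_target := Ψ.open_target.preimage (by fun_prop)
    continuousOn_toFun := continuous_snd.comp_continuousOn
      (Ψ.continuousOn.comp continuous_subtype_val.continuousOn fun _ h => h)
    continuousOn_invFun := by
      rw [continuousOn_iff_continuous_domRestrict, continuous_induced_rng]
      have h : Continuous fun y : {y | (c, y) ∈ Ψ.target} => Ψ.symm (c, (y : Z)) :=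
        Ψ.continuousOn_symm.comp_continuous (by fun_prop) fun y => y.2
      refine h.congr fun y => ?_
      have hy : (c, (y : Z)) ∈ Ψ.target := y.2
      simp [hy] }

section

variable {X Y Z : Type*} [TopologicalSpace X] [TopologicalSpace Y] [TopologicalSpace Z]
  {f : X → Y} {c : Y} (Ψ : OpenPartialHomeomorph X (Y × Z)) (hΨ : ∀ z, (Ψ z).1 = f z)
  (p : {z // f z = c})

theorem OpenPartialHomeomorph.coe_levelSet_symm {y : Z} (hy : (c, y) ∈ Ψ.target) :
    ((Ψ.levelSet hΨ p).symm y : X) = Ψ.symm (c, y) := by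
  have : (Ψ.levelSet hΨ p).symm y = ⟨Ψ.symm (c, y), by rw [← hΨ, Ψ.right_inv hy]⟩ := dif_pos hy
  rw [this]

end

/-- A regular fibre of a smooth map is a manifold, embedded in the ambient space. -/
theorem ContDiff.exists_isManifold_fibre {f : E → V} (hf : ContDiff ℝ ∞ f) {c : V}
    (hc : ∀ z, f z = c → Function.Surjective (fderiv ℝ f z))
    {d : ℕ} (hd : d = Module.finrank ℝ E - Module.finrank ℝ V) :
    ∃ (_ : ChartedSpace (EuclideanSpace ℝ (Fin d)) {z // f z = c})
      (_ : IsManifold (𝓡 d) ∞ {z // f z = c}),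
      ContMDiff (𝓡 d) 𝓘(ℝ, E) ∞ (Subtype.val : {z // f z = c} → E) ∧
      ∀ (W : TopologicalSpace.Opens E) (g : W → {z // f z = c}),
        ContMDiff 𝓘(ℝ, E) 𝓘(ℝ, E) ∞ (fun z => (g z : E)) →
          ContMDiff 𝓘(ℝ, E) (𝓡 d) ∞ g := by
  choose Ψ hpΨ hfΨ hΨ hΨs using fun p : {z // f z = c} =>
    hf.exists_openPartialHomeomorph_of_surjective (d := d) (by
      -- A point of the fibre forces `finrank V ≤ finrank E`, so the truncated subtraction defining
      -- `d` is genuine; an empty fibre needs no chart.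
      have := LinearMap.finrank_le_finrank_of_surjective
        (f := (fderiv ℝ f p : E →ₗ[ℝ] V)) (hc p p.2)
      omega) (hc p p.2)
  let e (p : {z // f z = c}) := (Ψ p).levelSet (hfΨ p) p
  have hsymm : ∀ p, ContDiffOn ℝ ∞ (fun y => ((e p).symm y : E)) (e p).target := fun p =>
    ((hΨs p).comp (contDiff_prodMk_right c).contDiffOn fun y hy => hy).congr
      fun y hy => (Ψ p).coe_levelSet_symm (hfΨ p) p hy
  let cs : ChartedSpace (EuclideanSpace ℝ (Fin d)) {z // f z = c} :=
    { atlas := range e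
      chartAt := e
      mem_chart_source := hpΨ
      chart_mem_atlas := mem_range_self }
  have hman : IsManifold (𝓡 d) ∞ {z // f z = c} := by
    refine isManifold_of_contDiffOn _ _ _ ?_
    rintro _ _ ⟨p, rfl⟩ ⟨q, rfl⟩
    simp only [modelWithCornersSelf_coe, modelWithCornersSelf_coe_symm, Function.comp_id,
      Function.id_comp, preimage_id, range_id, inter_univ]
    exact (hΨ q).snd.comp_contDiffOn ((hsymm p).mono fun y hy => hy.1)
  refine ⟨cs, hman, fun p => ?_, fun W g hg z => ?_⟩
  · rw [contMDiffAt_iff]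
    refine ⟨continuous_subtype_val.continuousAt, ?_⟩
    have hmem : e p p ∈ (e p).target := (e p).map_source (hpΨ p)
    simpa using! ((hsymm p).contDiffAt ((e p).open_target.mem_nhds hmem)).contDiffWithinAt
  · rw [contMDiffAt_iff_target]
    refine ⟨(continuous_induced_rng.2 hg.continuous).continuousAt, ?_⟩
    exact ((hΨ (g z)).snd.contMDiff.comp hg).contMDiffAt

end RegularFibre

/-! ### Lifting vector fields and parallel transport -/

section Lift

open Set

/-- A smooth family of linear maps has smooth local right inverses near a point where it is
surjective. -/
theorem ContDiff.exists_local_rightInverse {E F G : Type*} [NormedAddCommGroup E] [NormedSpace ℝ E]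
    [NormedAddCommGroup F] [NormedSpace ℝ F] [NormedAddCommGroup G] [NormedSpace ℝ G]
    [FiniteDimensional ℝ G] {L : E → F →L[ℝ] G} (hL : ContDiff ℝ ∞ L) {z₀ : E}
    (h₀ : Function.Surjective (L z₀)) :
    ∃ U ∈ 𝓝 z₀, ∃ s : E → G →L[ℝ] F, ContDiffOn ℝ ∞ s U ∧
      ∀ z ∈ U, ∀ w, L z (s z w) = w := by
  have : CompleteSpace G := FiniteDimensional.complete ℝ G
  obtain ⟨r, hr⟩ := (L z₀ : F →ₗ[ℝ] G).exists_rightInverse_of_surjective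
    (LinearMap.range_eq_top.2 h₀)
  set s₀ : G →L[ℝ] F := LinearMap.toContinuousLinearMap r
  have hA : ContDiff ℝ ∞ (fun z => (L z).comp s₀) := hL.clm_comp contDiff_const
  refine ⟨(fun z => (L z).comp s₀) ⁻¹' range ContinuousLinearEquiv.toContinuousLinearMap,
    (ContinuousLinearEquiv.isOpen.preimage hA.continuous).mem_nhds
      ⟨ContinuousLinearEquiv.refl ℝ G, ?_⟩,
    fun z => s₀.comp ((L z).comp s₀).inverse, ?_, ?_⟩
  · ext w
    exact (LinearMap.congr_fun hr w).symm
  · rintro z ⟨e, he⟩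
    have hinv : ContDiffAt ℝ ∞ (ContinuousLinearMap.inverse : (G →L[ℝ] G) → (G →L[ℝ] G))
        ((L z).comp s₀) := by
      have := contDiffAt_map_inverse (n := ∞) e
      rwa [he] at this
    exact ((contDiffAt_const (c := s₀)).clm_comp
      (hinv.comp z hA.contDiffAt)).contDiffWithinAt
  · rintro z ⟨e, he⟩ w
    simp only [ContinuousLinearMap.coe_comp, Function.comp_apply]
    change ((L z).comp s₀) (((L z).comp s₀).inverse w) = w
    simp only at he
    rw [← he, ContinuousLinearMap.inverse_equiv]
    exact e.apply_symm_apply w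

variable {E V : Type*} [NormedAddCommGroup E] [NormedSpace ℝ E] [FiniteDimensional ℝ E]
  [NormedAddCommGroup V] [NormedSpace ℝ V] [FiniteDimensional ℝ V]

/-- Constant vector fields on the target of `f`, cut off by `κ`, lift to smooth vector fields that
are tangent to the level sets of `ρ` above the level `R`. -/
theorem exists_contDiff_lift {f : E → V} (hf : ContDiff ℝ ∞ f) {ρ : E → ℝ} (hρ : ContDiff ℝ ∞ ρ)
    {κ : V → ℝ} (hκ : ContDiff ℝ ∞ κ) {R : ℝ}
    (hsurj : ∀ z, f z ∈ tsupport κ → Function.Surjective (fderiv ℝ f z))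
    (htan : ∀ z, f z ∈ tsupport κ → R ≤ ρ z →
      Function.Surjective ((fderiv ℝ f z).prod (fderiv ℝ ρ z))) :
    ∃ v : E → V →L[ℝ] E, ContDiff ℝ ∞ v ∧ (∀ z w, fderiv ℝ f z (v z w) = κ (f z) • w) ∧
      ∀ z, R ≤ ρ z → ∀ w, fderiv ℝ ρ z (v z w) = 0 := by
  have hdf : ContDiff ℝ ∞ (fderiv ℝ f) := (contDiff_infty_iff_fderiv.1 hf).2
  have hdρ : ContDiff ℝ ∞ (fderiv ℝ ρ) := (contDiff_infty_iff_fderiv.1 hρ).2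
  -- The conditions on a lift are affine, so local solutions can be glued by a partition of unity.
  let t : E → Set (V →L[ℝ] E) := fun z =>
    {A | (∀ w, fderiv ℝ f z (A w) = κ (f z) • w) ∧ (R ≤ ρ z → ∀ w, fderiv ℝ ρ z (A w) = 0)}
  have ht : ∀ z, Convex ℝ (t z) := by
    rintro z A ⟨hA, hA'⟩ B ⟨hB, hB'⟩ a b - - hab
    refine ⟨fun w => ?_, fun hR w => ?_⟩
    · simp [hA, hB, ← add_smul, hab]
    · simp [hA' hR, hB' hR]
  have hloc : ∀ z₀, ∃ U ∈ 𝓝 z₀, ∃ g : E → V →L[ℝ] E,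
      ContMDiffOn 𝓘(ℝ, E) 𝓘(ℝ, V →L[ℝ] E) ∞ g U ∧ ∀ z ∈ U, g z ∈ t z := by
    intro z₀
    by_cases hz : f z₀ ∈ tsupport κ
    · rcases lt_or_ge (ρ z₀) R with hR | hR
      · obtain ⟨U, hU, s, hs, hsr⟩ := hdf.exists_local_rightInverse (hsurj z₀ hz)
        refine ⟨U ∩ {z | ρ z < R}, inter_mem hU
          ((isOpen_lt hρ.continuous continuous_const).mem_nhds hR),
          fun z => κ (f z) • s z, ?_, fun z hz => ⟨fun w => ?_, fun h => ?_⟩⟩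
        · exact ((hκ.comp hf).contDiffOn.smul (hs.mono inter_subset_left)).contMDiffOn
        · simp [hsr z hz.1]
        · exact absurd h (not_le.2 hz.2)
      · have hdp : ContDiff ℝ ∞ fun z => (fderiv ℝ f z).prod (fderiv ℝ ρ z) :=
          (ContinuousLinearMap.prodₗᵢ (𝕜 := ℝ) (E := E) (F := V) (G := ℝ) ℝ).contDiff.comp
            (hdf.prodMk hdρ)
        obtain ⟨U, hU, s, hs, hsr⟩ := hdp.exists_local_rightInverse (htan z₀ hz hR)
        refine ⟨U, hU, fun z => κ (f z) • (s z).comp (ContinuousLinearMap.inl ℝ V ℝ), ?_,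
          fun z hz => ⟨fun w => ?_, fun _ w => ?_⟩⟩
        · exact ((hκ.comp hf).contDiffOn.smul (hs.clm_comp contDiffOn_const)).contMDiffOn
        · have := congrArg Prod.fst (hsr z hz (w, 0))
          simp only [ContinuousLinearMap.prod_apply] at this
          simp [this]
        · have := congrArg Prod.snd (hsr z hz (w, 0))
          simp only [ContinuousLinearMap.prod_apply] at this
          simp [this]
    · refine ⟨f ⁻¹' (tsupport κ)ᶜ,
        ((isClosed_tsupport κ).isOpen_compl.preimage hf.continuous).mem_nhds hz, fun _ => 0,
        contMDiffOn_const, fun z hz => ⟨fun w => ?_, fun _ w => ?_⟩⟩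
      · simp [image_eq_zero_of_notMem_tsupport hz]
      · simp
  obtain ⟨v, hv⟩ := exists_contMDiffMap_forall_mem_convex_of_local 𝓘(ℝ, E) ht hloc
  exact ⟨v, v.contMDiff.contDiff, fun z => (hv z).1, fun z => (hv z).2⟩

theorem IsIntegralCurveOn.hasDerivWithinAt_Ici {E : Type*} [NormedAddCommGroup E] [NormedSpace ℝ E]
    {γ : ℝ → E} {v : ℝ → E → E} {a b : ℝ} (hγ : IsIntegralCurveOn γ v (Icc a b)) {t : ℝ}
    (ht : t ∈ Ico a b) : HasDerivWithinAt γ (v t (γ t)) (Ici t) t :=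
  (hγ t (Ico_subset_Icc_self ht)).mono_of_mem_nhdsWithin (Icc_mem_nhdsGE_of_mem ht)

/-- Parallel transport: if `f` is a submersion over a closed ball, relative to the level sets of a
proper function `ρ` near infinity, then points over the open ball can be moved smoothly and
reversibly between the fibres of `f`. -/
theorem exists_contDiff_transport {f : E → V} (hf : ContDiff ℝ ∞ f) {ρ : E → ℝ}
    (hρ : ContDiff ℝ ∞ ρ) (hproper : ∀ a, Bornology.IsBounded {z | ρ z ≤ a}) {c : V} {δ R : ℝ}
    (hδ : 0 < δ)
    (hsurj : ∀ z, f z ∈ Metric.closedBall c (2 * δ) → Function.Surjective (fderiv ℝ f z))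
    (htan : ∀ z, f z ∈ Metric.closedBall c (2 * δ) → R ≤ ρ z →
      Function.Surjective ((fderiv ℝ f z).prod (fderiv ℝ ρ z))) :
    ∃ τ : E × V → E, ContDiff ℝ ∞ τ ∧
      ∀ z w, f z ∈ Metric.ball c δ → f z + w ∈ Metric.ball c δ →
        f (τ (z, w)) = f z + w ∧ τ (τ (z, w), -w) = z := by
  have : CompleteSpace E := FiniteDimensional.complete ℝ E
  have : CompleteSpace V := FiniteDimensional.complete ℝ V
  let κ : ContDiffBump c := ⟨δ, 2 * δ, hδ, by linarith⟩
  have hκs : tsupport κ = Metric.closedBall c (2 * δ) := κ.tsupport_eq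
  have hκ1 : ∀ y ∈ Metric.ball c δ, κ y = 1 := fun y hy =>
    κ.one_of_mem_closedBall (Metric.ball_subset_closedBall hy)
  obtain ⟨v, hv, hvf, hvρ⟩ := exists_contDiff_lift hf hρ (κ := κ) κ.contDiff (R := R)
    (by rwa [hκs]) (by rwa [hκs])
  have fst' : ∀ {g : ℝ → E × V} {g' : E × V} {s : Set ℝ} {t : ℝ}, HasDerivWithinAt g g' s t →
      HasDerivWithinAt (fun t => (g t).1) g'.1 s t := fun h =>
    (ContinuousLinearMap.fst ℝ E V).hasFDerivAt.comp_hasDerivWithinAt _ h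
  have snd' : ∀ {g : ℝ → E × V} {g' : E × V} {s : Set ℝ} {t : ℝ}, HasDerivWithinAt g g' s t →
      HasDerivWithinAt (fun t => (g t).2) g'.2 s t := fun h =>
    (ContinuousLinearMap.snd ℝ E V).hasFDerivAt.comp_hasDerivWithinAt _ h
  -- The direction `w` becomes a constant component of the state, so smoothness in `w` and in the
  -- initial point come together.
  set X : E × V → E × V := fun p => (v p.1 p.2, 0)
  have hX : ContDiff ℝ ∞ X := ((hv.comp contDiff_fst).clm_apply contDiff_snd).prodMk contDiff_const
  have hsnd : ∀ (b : E × V → ℝ) (γ : ℝ → E × V),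
      IsIntegralCurveOn γ (fun _ x => b x • X x) (Icc 0 1) →
        ∀ t ∈ Icc (0 : ℝ) 1, (γ t).2 = (γ 0).2 := by
    intro b γ hγ
    refine constant_of_has_deriv_right_zero (continuous_snd.comp_continuousOn hγ.continuousOn)
      fun t ht => ?_
    have := snd' (hγ.hasDerivWithinAt_Ici ht)
    simpa [X] using this
  have hfst : ∀ (b : E × V → ℝ) (γ : ℝ → E × V),
      IsIntegralCurveOn γ (fun _ x => b x • X x) (Icc 0 1) →
        ∀ t ∈ Icc (0 : ℝ) 1, ρ (γ t).1 ≤ max (ρ (γ 0).1) R + 1 := by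
    intro b γ hγ t ht
    -- The barrier has slope `1`, while `ρ` has derivative `0` along the curve wherever it meets the
    -- barrier, since there `R ≤ ρ`. The factor `b` plays no role.
    have key := image_le_of_deriv_right_lt_deriv_boundary (f := fun t => ρ (γ t).1)
      (f' := fun t => fderiv ℝ ρ (γ t).1 (b (γ t) • v (γ t).1 (γ t).2)) (a := 0) (b := 1)
      (B := fun t => max (ρ (γ 0).1) R + t) (B' := fun _ => 1)
      (hρ.continuous.comp_continuousOn (continuous_fst.comp_continuousOn hγ.continuousOn))
      (fun s hs => ((hρ.differentiable (by simp) _).hasFDerivAt.comp_hasDerivWithinAt s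
        (fst' (hγ.hasDerivWithinAt_Ici hs)))) (by simp)
      (fun s => (hasDerivAt_id s).const_add _) (fun s hs h => ?_) ht
    · exact key.trans (by gcongr; exact ht.2)
    · have hR : R ≤ ρ (γ s).1 := by
        rw [h]
        exact (le_max_right _ _).trans (le_add_of_nonneg_right hs.1)
      simp [hvρ _ hR]
  obtain ⟨T, hT, hex, hTγ⟩ := exists_contDiff_timeOne_of_bounded hX (by
    intro r
    obtain ⟨a, ha⟩ := ((isCompact_closedBall (0 : E) r).image hρ.continuous).bddAbove
    obtain ⟨M, hM⟩ := (hproper (max a R + 1)).exists_norm_le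
    refine ⟨max M r, fun b γ hγ h0 t ht => ?_⟩
    have h1 : ρ (γ 0).1 ≤ a := ha ⟨_, by
      rw [mem_closedBall_zero_iff]
      exact (norm_fst_le _).trans h0, rfl⟩
    refine max_le_max (hM _ ((hfst b γ hγ t ht).trans ?_)) ?_
    · gcongr
    · rw [hsnd b γ hγ t ht]
      exact (norm_snd_le _).trans h0)
  refine ⟨fun p => (T p).1, hT.fst, fun z w hz hw => ?_⟩
  obtain ⟨γ, h0, hγ⟩ := hex (z, w)
  have hγ2 : ∀ t ∈ Icc (0 : ℝ) 1, (γ t).2 = w := fun t ht => by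
    rw [hsnd (fun _ => 1) γ (by simpa using hγ) t ht, h0]
  have hγ1 : T (z, w) = γ 1 := by rw [hTγ γ hγ, h0]
  constructor
  · obtain ⟨K, hK⟩ := κ.contDiff.lipschitzWith_of_hasCompactSupport (𝕂 := ℝ) (n := ∞)
      κ.hasCompactSupport (by simp)
    have hKw : LipschitzWith (K * ‖w‖₊) (fun y => κ y • w) := by
      refine LipschitzWith.of_dist_le_mul fun x y => ?_
      rw [dist_eq_norm, ← sub_smul, norm_smul, ← dist_eq_norm, NNReal.coe_mul, coe_nnnorm]
      nlinarith [hK.dist_le_mul x y, norm_nonneg w]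
    have hline : ∀ t ∈ Icc (0 : ℝ) 1, f z + t • w ∈ Metric.ball c δ := fun t ht =>
      (convex_ball c δ).add_smul_mem hz hw ht
    -- Both `f ∘ γ` and the segment `f z + t • w` solve `y' = κ y • w`; the segment does because it
    -- stays in the ball where `κ = 1`.
    have := ODE_solution_unique_of_mem_Icc_right (v := fun _ y => κ y • w) (s := fun _ => univ)
      (f := fun t => f (γ t).1) (g := fun t : ℝ => f z + t • w) (a := 0) (b := 1)
      (fun t _ => hKw.lipschitzOnWith)
      (hf.continuous.comp_continuousOn (continuous_fst.comp_continuousOn hγ.continuousOn))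
      (fun t ht => by
        have := (hf.differentiable (by simp) _).hasFDerivAt.comp_hasDerivWithinAt t
          (fst' (hγ.hasDerivWithinAt_Ici ht))
        simp only [X, hvf, hγ2 t (Ico_subset_Icc_self ht)] at this
        exact this)
      (fun _ _ => mem_univ _) (by fun_prop)
      (fun t ht => by
        rw [hκ1 _ (hline t (Ico_subset_Icc_self ht))]
        exact (((hasDerivAt_id t).smul_const w).const_add _).hasDerivWithinAt)
      (fun _ _ => mem_univ _) (by simp [h0]) (right_mem_Icc.2 zero_le_one)
    simpa [hγ1] using this
  -- The reversed curve is integral for the parameter `-w` and runs from `τ (z, w)` back to `z`.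
  · have hrev : IsIntegralCurveOn (fun t : ℝ => ((γ (1 - t)).1, -w)) (fun _ => X) (Icc 0 1) := by
      intro t ht
      have ht' : 1 - t ∈ Icc (0 : ℝ) 1 := ⟨by linarith [ht.2], by linarith [ht.1]⟩
      have h1 : HasDerivWithinAt (fun t : ℝ => 1 - t) (-1) (Icc 0 1) t := by
        simpa using ((hasDerivAt_id t).const_sub 1).hasDerivWithinAt
      have h2 := fst' ((hγ _ ht').scomp t h1
        (fun s hs => ⟨by linarith [hs.2], by linarith [hs.1]⟩))
      have h3 := h2.prodMk (hasDerivWithinAt_const t (Icc (0 : ℝ) 1) (-w))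
      simpa [X, hγ2 _ ht'] using h3
    have := hTγ _ hrev
    simp only [sub_zero, sub_self, h0] at this
    simp only [hγ1, ← this]

end Lift

/-! ### Milnor set, regularity near a value, and trivialisation -/

section MixedPolynomial

variable {n : ℕ} {f : Cn n → ℂ}

theorem IsMixedPolynomial.contDiff (hf : IsMixedPolynomial f) : ContDiff ℝ ∞ f := by
  obtain ⟨P, hP⟩ := hf
  rw [show f = _ from funext hP]
  clear hP
  have hcoord : ∀ k : Fin n, ContDiff ℝ ∞ fun z : Cn n => z k := fun k => by fun_prop
  induction P using MvPolynomial.induction_on with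
  | C a => simpa using contDiff_const
  | add p q hp hq => simpa using hp.add hq
  | mul_X p i hp =>
    simp only [map_mul, MvPolynomial.eval_X]
    refine hp.mul ?_
    rcases i with k | k
    · exact hcoord k
    · exact Complex.conjCLE.contDiff.comp (hcoord k)

/-- A point at which some nonzero real combination of the two real differentials of `f` is a
multiple of the position vector lies in the Milnor set. -/
theorem mem_milnorSet_of_inner {z : Cn n} {μ : ℂ} (hμ : μ ≠ 0) {l : ℝ}
    (h : ∀ v, inner ℝ μ (fderiv ℝ f z v) = l * inner ℝ z v) : z ∈ milnorSet f := by
  refine ⟨l, μ, hμ, fun k => ?_⟩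
  have hx := h (EuclideanSpace.single k 1)
  have hy := h (EuclideanSpace.single k Complex.I)
  change inner ℝ μ (partialX f z k) = _ at hx
  change inner ℝ μ (partialY f z k) = _ at hy
  have e : ∀ w : ℂ, inner ℝ z (EuclideanSpace.single k w) = inner ℝ (z k) w := fun w => by
    rw [PiLp.inner_apply, Finset.sum_eq_single k] <;> simp +contextual
  rw [e] at hx hy
  simp only [Complex.inner] at hx hy
  simp only [partialZ, partialZbar]
  apply Complex.ext
  · simp [map_ofNat] at hx hy ⊢
    linarith
  · simp [map_ofNat] at hx hy ⊢
    linarith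

/-- Real linear functionals on `ℂ` are represented by the real inner product. -/
theorem Complex.exists_eq_inner (ψ : ℂ →ₗ[ℝ] ℝ) : ∃ μ : ℂ, ∀ w, ψ w = inner ℝ μ w :=
  ⟨(InnerProductSpace.toDual ℝ ℂ).symm (LinearMap.toContinuousLinearMap ψ), fun w => by simp⟩

/-- A functional `inner ℝ μ` killing the image of the differential gives the Milnor condition with
`l = 0`. Hence critical points of large norm are controlled by `S(f)`. -/
theorem singularLocus_subset_milnorSet : singularLocus f ⊆ milnorSet f := by
  intro z hz
  have hlt : (fderiv ℝ f z : Cn n →ₗ[ℝ] ℂ).range < ⊤ :=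
    lt_top_iff_ne_top.2 fun h => hz (LinearMap.range_eq_top.1 h)
  obtain ⟨ψ, hψ, hle⟩ := Submodule.exists_le_ker_of_lt_top _ hlt
  obtain ⟨μ, hμ⟩ := Complex.exists_eq_inner ψ
  refine mem_milnorSet_of_inner (μ := μ) (l := 0) ?_ fun v => ?_
  · rintro rfl
    exact hψ (LinearMap.ext fun w => by simp [hμ])
  · rw [← hμ, zero_mul]
    exact hle ⟨v, rfl⟩

/-- Away from the origin, the complement of the Milnor set consists of points where `f` is a
submersion along the sphere. -/
theorem surjective_fderiv_prod_of_notMem_milnorSet {z : Cn n} (hz0 : z ≠ 0)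
    (hz : z ∉ milnorSet f) :
    Function.Surjective ((fderiv ℝ f z).prod (fderiv ℝ (fun z : Cn n => ‖z‖ ^ 2) z)) := by
  have hρ : ∀ v, fderiv ℝ (fun z : Cn n => ‖z‖ ^ 2) z v = 2 * inner ℝ z v := fun v => by
    rw [fderiv_norm_sq_apply]
    simp
  by_contra hns
  have hlt : (((fderiv ℝ f z).prod (fderiv ℝ (fun z : Cn n => ‖z‖ ^ 2) z) :
      Cn n →L[ℝ] ℂ × ℝ) : Cn n →ₗ[ℝ] ℂ × ℝ).range < ⊤ :=
    lt_top_iff_ne_top.2 fun h => hns (LinearMap.range_eq_top.1 h)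
  obtain ⟨ψ, hψ, hle⟩ := Submodule.exists_le_ker_of_lt_top _ hlt
  obtain ⟨μ, hμ⟩ := Complex.exists_eq_inner (ψ ∘ₗ LinearMap.inl ℝ ℂ ℝ)
  have hdec : ∀ (w : ℂ) (t : ℝ), ψ (w, t) = inner ℝ μ w + t * ψ (0, 1) := fun w t => by
    have : ((w, t) : ℂ × ℝ) = (w, 0) + t • (0, 1) := by simp
    rw [this, map_add, map_smul, ← hμ]
    rfl
  have hker : ∀ v, inner ℝ μ (fderiv ℝ f z v) + 2 * inner ℝ z v * ψ (0, 1) = 0 := fun v => by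
    rw [← hρ, ← hdec]
    exact hle ⟨v, rfl⟩
  -- If `μ = 0`, taking `v = z ≠ 0` in `hker` forces `ψ (0, 1) = 0`, hence `ψ = 0`.
  have hμ0 : μ ≠ 0 := by
    rintro rfl
    have h := hker z
    simp only [inner_zero_left, zero_add, mul_eq_zero, inner_self_eq_zero, hz0] at h
    have h1 : ψ (0, 1) = 0 := by simpa using h
    refine hψ (LinearMap.ext fun p => ?_)
    rw [← Prod.mk.eta (p := p), hdec, h1]
    simp
  exact hz (mem_milnorSet_of_inner hμ0 (l := -2 * ψ (0, 1)) fun v => by linarith [hker v])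

theorem isClosed_singularLocus (hf : ContDiff ℝ ∞ f) : IsClosed (singularLocus f) := by
  rw [← isOpen_compl_iff, isOpen_iff_mem_nhds]
  intro z hz
  obtain ⟨U, hU, s, -, hs⟩ := (contDiff_infty_iff_fderiv.1 hf).2.exists_local_rightInverse
    (not_not.1 hz)
  filter_upwards [hU] with y hy
  exact not_not.2 fun w => ⟨s y w, hs y hy w⟩

/-- Near a value outside `S(f)`, the Milnor set is bounded. -/
theorem exists_forall_mem_milnorSet_lt {c : ℂ} (hc : c ∉ asymptoticNonregularValues f) :
    ∃ R δ : ℝ, 0 < δ ∧ ∀ z ∈ milnorSet f, R ≤ ‖z‖ → δ < dist (f z) c := by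
  by_contra! h
  choose z hz hR hd using fun k : ℕ => h k (1 / (k + 1)) Nat.one_div_pos_of_nat
  refine hc ⟨z, hz, tendsto_atTop_mono hR tendsto_natCast_atTop_atTop, ?_⟩
  exact tendsto_iff_dist_tendsto_zero.2
    (squeeze_zero (fun _ => dist_nonneg) hd tendsto_one_div_add_atTop_nhds_zero_nat)

/-- Critical points in a large ball have compact image missing `c`; those outside it are Milnor
points, whose values stay away from `c`. -/
theorem exists_forall_closedBall_regular (hf : ContDiff ℝ ∞ f) {c : ℂ}
    (hS : c ∉ f '' singularLocus f) (hA : c ∉ asymptoticNonregularValues f) :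
    ∃ R δ : ℝ, 0 < R ∧ 0 < δ ∧ ∀ z, f z ∈ Metric.closedBall c (2 * δ) →
      z ∉ singularLocus f ∧ (R ≤ ‖z‖ → z ∉ milnorSet f) := by
  obtain ⟨R, ε, hε, hM⟩ := exists_forall_mem_milnorSet_lt hA
  have hcpt : IsCompact (f '' (singularLocus f ∩ Metric.closedBall 0 R)) :=
    ((isCompact_closedBall 0 R).inter_left (isClosed_singularLocus hf)).image hf.continuous
  obtain ⟨η, hη, hball⟩ := Metric.isOpen_iff.1 hcpt.isClosed.isOpen_compl c
    fun h => hS (Set.image_mono Set.inter_subset_left h)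
  have hmin : 0 < min ε η := lt_min hε hη
  -- The quarter makes `2 * δ` strictly smaller than both `ε` and `η`.
  refine ⟨max R 1, min ε η / 4, by positivity, by positivity, fun z hz => ?_⟩
  rw [Metric.mem_closedBall] at hz
  have h1 : dist (f z) c < ε := by linarith [min_le_left ε η]
  have h2 : dist (f z) c < η := by linarith [min_le_right ε η]
  refine ⟨fun hs => ?_, fun hR hm => (hM z hm ((le_max_left _ _).trans hR)).not_gt h1⟩
  rcases le_total ‖z‖ R with hR | hR
  · exact hball h2 ⟨z, ⟨hs, by simpa using hR⟩, rfl⟩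
  · exact (hM z (singularLocus_subset_milnorSet hs) hR).not_gt h1

/-- Each point is transported to the fibre over `c`; the inverse sends `(y, p)` to `τ (p, y - c)`,
by reversibility of `τ`. -/
theorem isTrivialSmoothFibrationOver_ball (hf : ContDiff ℝ ∞ f) {c : ℂ} {R δ : ℝ} (hR : 0 < R)
    (hδ : 0 < δ) (hreg : ∀ z, f z ∈ Metric.closedBall c (2 * δ) →
      z ∉ singularLocus f ∧ (R ≤ ‖z‖ → z ∉ milnorSet f)) :
    IsTrivialSmoothFibrationOver f ⟨Metric.ball c δ, Metric.isOpen_ball⟩ := by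
  have hsurj : ∀ z, f z ∈ Metric.closedBall c (2 * δ) → Function.Surjective (fderiv ℝ f z) :=
    fun z hz => not_not.1 (hreg z hz).1
  obtain ⟨τ, hτ, hτf⟩ := exists_contDiff_transport hf (ρ := fun z : Cn n => ‖z‖ ^ 2)
    (contDiff_norm_sq ℝ) (fun a => (Metric.isBounded_closedBall (x := (0 : Cn n)) (r := √a)).subset
      fun z hz => by simpa using Real.le_sqrt_of_sq_le hz) (R := R ^ 2) hδ hsurj
    fun z hz hRz => by
      have hRz' : R ≤ ‖z‖ := (sq_le_sq₀ hR.le (norm_nonneg z)).1 hRz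
      exact surjective_fderiv_prod_of_notMem_milnorSet (norm_pos_iff.1 (hR.trans_le hRz'))
        ((hreg z hz).2 hRz')
  have hcc : c ∈ Metric.ball c δ := Metric.mem_ball_self hδ
  obtain ⟨d, hd⟩ : ∃ d, d = Module.finrank ℝ (Cn n) - Module.finrank ℝ ℂ := ⟨_, rfl⟩
  obtain ⟨cs, hman, hval, hlift⟩ := hf.exists_isManifold_fibre (c := c)
    (fun z hz => hsurj z (by rw [hz]; exact Metric.mem_closedBall_self (by positivity))) hd
  let U : TopologicalSpace.Opens ℂ := ⟨Metric.ball c δ, Metric.isOpen_ball⟩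
  let W : TopologicalSpace.Opens (Cn n) := ⟨f ⁻¹' U, U.isOpen.preimage hf.continuous⟩
  have hWz : ∀ z : W, f z ∈ Metric.ball c δ := fun z => z.2
  have hto : ∀ z : W, f (τ (z, c - f z)) = c ∧ τ (τ (z, c - f z), -(c - f z)) = z := fun z => by
    simpa using hτf z (c - f z) (hWz z) (by simpa using hδ)
  have hinv : ∀ p : U × {z // f z = c}, f (τ (p.2, p.1 - c)) = p.1 ∧
      τ (τ (p.2, p.1 - c), -(p.1 - c)) = p.2 := fun p => by
    have hp : f p.2 = c := p.2.2
    have h := hτf p.2 (p.1 - c) (by rw [hp]; exact hcc) (by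
      rw [hp, add_sub_cancel]
      exact p.1.2)
    rwa [hp, add_sub_cancel] at h
  let e : W ≃ U × {z // f z = c} :=
    { toFun := fun z => (⟨f z, z.2⟩, ⟨τ (z, c - f z), (hto z).1⟩)
      invFun := fun p => ⟨τ (p.2, p.1 - c), by
        change f _ ∈ U
        rw [(hinv p).1]
        exact p.1.2⟩
      left_inv := fun z => Subtype.ext (by
        have := (hto z).2
        rwa [neg_sub] at this)
      right_inv := fun p => by
        refine Prod.ext (Subtype.ext (hinv p).1) (Subtype.ext ?_)
        have := (hinv p).2
        rw [neg_sub] at this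
        simp only [(hinv p).1, this] }
  have hWval : ContMDiff 𝓘(ℝ, Cn n) 𝓘(ℝ, Cn n) ∞ (Subtype.val : W → Cn n) := contMDiff_subtype_val
  have hUval : ContMDiff 𝓘(ℝ, ℂ) 𝓘(ℝ, ℂ) ∞ (Subtype.val : U → ℂ) := contMDiff_subtype_val
  refine ⟨W, rfl, _, _, inferInstance, cs, hman, ⟨e, ?_, ?_⟩, fun z => rfl⟩
  · refine ContMDiff.prodMk ?_ (hlift W _ ?_)
    · rw [← ContMDiff.subtypeVal_comp_iff]
      exact hf.contMDiff.comp hWval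
    · exact (hτ.comp (contDiff_id.prodMk (contDiff_const.sub hf))).contMDiff.comp hWval
  · rw [← ContMDiff.subtypeVal_comp_iff]
    have h1 := hval.comp (contMDiff_snd (I := 𝓘(ℝ, ℂ)) (M := U) (n := ∞))
    have h2 := hUval.comp (contMDiff_fst (J := 𝓡 d) (N := {z // f z = c}) (n := ∞))
    exact hτ.contMDiff.comp (h1.prodMk_space (h2.sub contMDiff_const))

end MixedPolynomial

theorem theorem2p8 (n : ℕ) (f : Cn n → ℂ) (hf : IsMixedPolynomial f) :
    IsLocallyTrivialSmoothFibrationOver f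
        (f '' singularLocus f ∪ asymptoticNonregularValues f)ᶜ ∧
      bifurcationSet f ⊆ f '' singularLocus f ∪ asymptoticNonregularValues f := by
  have main : IsLocallyTrivialSmoothFibrationOver f
      (f '' singularLocus f ∪ asymptoticNonregularValues f)ᶜ := by
    intro c hc
    obtain ⟨R, δ, hR, hδ, hreg⟩ := exists_forall_closedBall_regular hf.contDiff
      (fun h => hc (Or.inl h)) (fun h => hc (Or.inr h))
    have hsub : Metric.ball c δ ⊆ Metric.closedBall c (2 * δ) :=
      Metric.ball_subset_closedBall.trans (Metric.closedBall_subset_closedBall (by linarith))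
    refine ⟨⟨Metric.ball c δ, Metric.isOpen_ball⟩, Metric.mem_ball_self hδ, ?_,
      isTrivialSmoothFibrationOver_ball hf.contDiff hR hδ hreg⟩
    rintro y hy (⟨z, hz, rfl⟩ | ⟨z, hz, hzn, hzy⟩)
    · exact (hreg z (hsub hy)).1 hz
    -- A value of `S(f)` in the ball would produce Milnor points of norm at least `R` over the ball.
    · obtain ⟨k, hk, hk'⟩ := ((hzy.eventually (Metric.isOpen_ball.mem_nhds hy)).and
        (hzn.eventually_ge_atTop R)).exists
      exact (hreg (z k) (hsub hk)).2 hk' (hz k)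
  exact ⟨main, (isLeast_bifurcationSet f).2 main⟩
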